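/- For a scheme $X$ of finite type over $\mathbb{Z}$ let $[X]$ denote the function $q\mapsto \#X(\mathbb{F}_q)$ from the set $\mathcal{Q}$ of prime powers to $\mathbb{Z}\subset\mathbb{Q}$. Let $\mathcal{S}\subset\mathbb{Z}[q]$ be the saturated multiplicative system generated by the polynomials $q^n-q$, $n>1$, and let $\mathsf{R}=\mathcal{S}^{-1}\mathbb{Z}[q]$. Since the elements of $\mathcal{S}$ do not vanish on $\mathcal{Q}$, $\mathsf{R}$ acts by pointwise multiplication on functions $\mathcal{Q}\to\mathbb{Q}$. For a finite simple graph $G$ with vertices $v_1,\dots,v_n$ let $Z_G$ be the scheme over $\mathbb{Z}$ of all nondegenerate symmetric $n\times n$ matrices $M$ with $M_{ij}=0$ whenever there is an edge from $v_i$ to $v_j$; that is, $Z_G=\operatorname{Spec}\,(\mathbb{Z}[y_{ij}]/J)_{\det(y_{ij})}$, where $J$ is generated by all $y_{ij}-y_{ji}$ and by the $y_{ij}$ for which $v_iv_j$ is an edge. Let $\mathbf{Graphs}_*$ be the $\mathsf{R}$-module of functions $\mathcal{Q}\to\mathbb{Q}$ generated by all $[Z_G]$, for $G$ a finite simple graph.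 For a matroid $M$ on a finite set $E$, with rank function $\rho$ and rank $r=\rho(E)$, let $X(M)$ be the scheme over $\mathbb{Z}$ of representations of $M$ in $r$-space: the locally closed subscheme of the affine space of $E\times r$ matrices (regarded as functions $f$ from $E$ to $r$-space) on which, for every $A\subseteq E$, all $(\rho(A)+1)\times(\rho(A)+1)$ minors with rows in $A$ vanish and at least one $\rho(A)\times\rho(A)$ minor with rows in $A$ is invertible. Thus, for a field $K$, $X(M)(K)$ is the set of all maps $f:E\to K^r$ with $\dim\operatorname{span} f(A)=\rho(A)$ for all $A\subseteq E$. Let $\mathbf{Matroids}$ be the $\mathsf{R}$-module of functions $\mathcal{Q}\to\mathbb{Q}$ generated by all $[X(M)]$, for $M$ a finite matroid. Theorem. $\mathbf{Matroids}\subset\mathbf{Graphs}_*$. -/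

import Mathlib

noncomputable section

open Polynomial AlgebraicGeometry

namespace GraphMatroid

/-! ### The ring `R = S⁻¹ ℤ[q]` and its action on functions of a prime power -/

/-- The set of prime powers `q = p ^ k`, `k ≥ 1`. -/
abbrev PrimePower : Type := {q : ℕ // IsPrimePow q}

/-- The saturated multiplicative system in `ℤ[q]` generated by the `q ^ n - q` for `n > 1`. -/
def denominators : Submonoid ℤ[X] :=
  (Submonoid.closure {f : ℤ[X] | ∃ n : ℕ, 1 < n ∧ f = X ^ n - X}).saturation.toSubmonoid

/-- The ring `S⁻¹ ℤ[q]`. -/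
abbrev R : Type := Localization denominators

/-- A polynomial in `ℤ[q]` as a function on prime powers. -/
def evalPoly : ℤ[X] →+* (PrimePower → ℚ) :=
  RingHom.pi fun q => Polynomial.eval₂RingHom (Int.castRingHom ℚ) (q.1 : ℚ)

theorem evalPoly_apply (f : ℤ[X]) (q : PrimePower) :
    evalPoly f q = f.eval₂ (Int.castRingHom ℚ) (q.1 : ℚ) := rfl

theorem isUnit_evalPoly (s : denominators) : IsUnit (evalPoly s) := by
  obtain ⟨s, hs⟩ := s
  change IsUnit (evalPoly s)
  have hs' : s ∈ (Submonoid.closure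
    {f : ℤ[X] | ∃ n : ℕ, 1 < n ∧ f = X ^ n - X}).saturation := hs
  rw [Submonoid.mem_saturation_iff_exists_dvd] at hs'
  obtain ⟨t, ht, hst⟩ := hs'
  refine isUnit_of_dvd_unit (map_dvd evalPoly hst) ?_
  suffices h : Submonoid.closure {f : ℤ[X] | ∃ n : ℕ, 1 < n ∧ f = X ^ n - X} ≤
      (IsUnit.submonoid (PrimePower → ℚ)).comap evalPoly from h ht
  rw [Submonoid.closure_le]
  rintro _ ⟨n, hn, rfl⟩
  change IsUnit (evalPoly _)
  rw [Pi.isUnit_iff]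
  intro q
  rw [isUnit_iff_ne_zero, evalPoly_apply]
  have hq : (1 : ℚ) < (q.1 : ℚ) := by exact_mod_cast q.2.one_lt
  have h := pow_lt_pow_right₀ hq hn
  rw [pow_one] at h
  simpa [sub_eq_zero] using h.ne'

/-- An element of `R` as an (everywhere defined) function from prime powers to `ℚ`. -/
def evalR : R →+* (PrimePower → ℚ) :=
  IsLocalization.lift (M := denominators) isUnit_evalPoly

/-- The `R`-module structure on functions from prime powers to `ℚ`: an element of `R` acts by
pointwise multiplication with its values. -/
instance : Module R (PrimePower → ℚ) := Module.compHom _ evalR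

/-! ### Counting points of schemes -/

instance (q : PrimePower) : Fact (Nat.minFac q.1).Prime :=
  ⟨Nat.minFac_prime q.2.ne_one⟩

/-- The field with `q` elements: `q = p ^ k` with `p` the smallest prime factor of `q` and `k` the
multiplicity of `p` in `q`. -/
abbrev Fq (q : PrimePower) : Type :=
  GaloisField q.1.minFac (q.1.factorization q.1.minFac)

/-- The function `[X] : q ↦ # X(𝔽_q)`. -/
def pointCount (Y : Scheme.{0}) : PrimePower → ℚ :=
  fun q => (Nat.card (Spec (CommRingCat.of (Fq q)) ⟶ Y) : ℚ)

/-! ### The schemes `Z_G` -/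

/-- The ideal of `ℤ[y_{vw}]` generated by `y_{vw} - y_{wv}` for all `v, w`, and by `y_{vw}` for all
edges `vw` of `G`. -/
def symIdeal {V : Type} (G : SimpleGraph V) : Ideal (MvPolynomial (V × V) ℤ) :=
  Ideal.span ({f | ∃ v w, f = MvPolynomial.X (v, w) - MvPolynomial.X (w, v)} ∪
    {f | ∃ v w, G.Adj v w ∧ f = MvPolynomial.X (v, w)})

open Classical in
/-- The determinant of the generic matrix `(y_{vw})`, in the quotient by `symIdeal G`. -/
def symDet {V : Type} [Fintype V] (G : SimpleGraph V) :
    MvPolynomial (V × V) ℤ ⧸ symIdeal G :=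
  Ideal.Quotient.mk (symIdeal G)
    (Matrix.det (Matrix.of fun v w : V => (MvPolynomial.X (v, w) : MvPolynomial (V × V) ℤ)))

/-- `Z_G`: the scheme of nondegenerate symmetric matrices, with rows and columns indexed by the
vertices of `G`, whose `(v, w)` entry vanishes whenever `vw` is an edge of `G`. -/
def ZScheme {V : Type} [Fintype V] (G : SimpleGraph V) : Scheme.{0} :=
  Spec (CommRingCat.of (Localization.Away (symDet G)))

/-! ### The representation schemes of matroids -/

/-- The `k × k` minors of the generic `E × s` matrix `(y_{ej})` whose rows lie in `A ⊆ E`. -/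
def minors {E : Type} (s : ℕ) (A : Set E) (k : ℕ) : Set (MvPolynomial (E × Fin s) ℤ) :=
  {f | ∃ (a : Fin k ↪ E) (b : Fin k ↪ Fin s), (∀ i, a i ∈ A) ∧
    f = Matrix.det (Matrix.of fun i j : Fin k =>
      (MvPolynomial.X (a i, b j) : MvPolynomial (E × Fin s) ℤ))}

/-- The rank function of a finite matroid, on subsets of its ground set. -/
def rankFun {α : Type} (M : Matroid α) (A : Set M.E) : ℕ :=
  (M.eRk (Subtype.val '' A)).toNat

/-- The ideal generated by all minors of size `ρ(A) + 1` with rows in `A`, for all `A ⊆ E`. -/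
def repIdeal {α : Type} (M : Matroid α) (s : ℕ) : Ideal (MvPolynomial (M.E × Fin s) ℤ) :=
  Ideal.span (⋃ A : Set M.E, minors s A (rankFun M A + 1))

/-- The open subset of `Spec (ℤ[y] / repIdeal M s)` on which, for every `A ⊆ E`, at least one minor
of size `ρ(A)` with rows in `A` is invertible. (The intersection is finite for finite `M`.) -/
def repOpen {α : Type} (M : Matroid α) (s : ℕ) :
    (Spec (CommRingCat.of (MvPolynomial (M.E × Fin s) ℤ ⧸ repIdeal M s))).Opens :=
  ⨅ A : Set M.E, ⨆ m : minors s A (rankFun M A),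
    PrimeSpectrum.basicOpen (Ideal.Quotient.mk (repIdeal M s) m.1)

/-- `X(M, s)`: the scheme of representations of `M` in affine `s`-space, that is of functions `f`
from the ground set to `𝔸 ^ s` such that `f` restricted to `A` has rank exactly `ρ(A)` for every
subset `A` of the ground set. -/
def repScheme {α : Type} (M : Matroid α) (s : ℕ) : Scheme.{0} := (repOpen M s).toScheme

/-! ### The two modules -/

/-- `Graphs_*`: the `R`-module generated by the functions `[Z_G]`, for `G` a finite simple graph. -/
def graphsStar : Submodule R (PrimePower → ℚ) :=
  Submodule.span R
    {φ | ∃ (V : Type) (_ : Fintype V) (G : SimpleGraph V), φ = pointCount (ZScheme G)}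

/-- `Matroids`: the `R`-module generated by the functions `[X(M)]`, where `M` is a finite matroid
and `X(M) = X(M, r)` with `r` the rank of `M`. -/
def matroids : Submodule R (PrimePower → ℚ) :=
  Submodule.span R
    {φ | ∃ (α : Type) (M : Matroid α), M.Finite ∧ φ = pointCount (repScheme M M.eRank.toNat)}

end GraphMatroid

end

noncomputable section

open Polynomial AlgebraicGeometry

namespace GraphMatroid

/-! ### Ranks of symmetric matrices under bordering -/

section Border

open Module Submodule

/-! The counts of symmetric matrices with prescribed zeros stay in `graphsStar` when row-rank
conditions are imposed, and matroid representations can be encoded by such matrices.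

Adding a vertex adjacent to a vertex set `A` means bordering a symmetric `B` by a vector `x`
vanishing on `A` and a diagonal entry `c`. If `x = B y`, exactly one `c` keeps the rank and every
other `c` raises it by 1; if `x` is outside the column space, the rank rises by 2. The column space
contains `q ^ (rank B - rk A)` such `x`, where `rk A` is the rank of the rows in `A`. So a new
vertex produces, up to known factors, the weight `q ^ (|A| - rk A)`, and repetition produces all
powers of this weight. As differences of distinct powers of `q` are invertible in `R`, Lagrange
interpolation (`sum_level_mem`) then isolates each value of `rk A`.

For `A = ∅` the recursion reduces the count of matrices of any rank to full rank, that is to the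
`[Z_G]` (`defectSum_empty_mem`). General `A` follows (`defectSum_mem`), so one can demand that the
rank `s` be attained on rows `T`. Once this is demanded also after bordering, the rank cannot
change, and further conditions can be imposed one at a time (`rankCondCount_mem`).

Finally take `s` pairwise adjacent vertices and isolated vertices `E`. The matrices of rank `s`,
attained on the `s` vertices, are the block matrices `[[F D⁻¹ Fᵀ, F], [Fᵀ, D]]` with `D` diagonal
invertible, and their rows in `A ⊆ E` have the rank of those of `F`. Their count is `(q - 1) ^ s`
times the count of representations. -/

/-- The symmetric matrix on `Option V` obtained from `B` by adding the row and column `x` with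
diagonal entry `c`. -/
def border {R V : Type*} (B : Matrix V V R) (x : V → R) (c : R) :
    Matrix (Option V) (Option V) R :=
  Matrix.of fun i j => i.elim (j.elim c x) fun v => j.elim (x v) (B v)

@[simp] theorem border_none_none {R V : Type*} (B : Matrix V V R) (x : V → R) (c : R) :
    border B x c none none = c := rfl
@[simp] theorem border_none_some {R V : Type*} (B : Matrix V V R) (x : V → R) (c : R) (v : V) :
    border B x c none (some v) = x v := rfl
@[simp] theorem border_some_none {R V : Type*} (B : Matrix V V R) (x : V → R) (c : R) (v : V) :
    border B x c (some v) none = x v := rfl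
@[simp] theorem border_some_some {R V : Type*} (B : Matrix V V R) (x : V → R) (c : R) (v w : V) :
    border B x c (some v) (some w) = B v w := rfl

theorem range_row_border {R V : Type*} (B : Matrix V V R) (x : V → R) (c : R) :
    Set.range (border B x c).row =
      insert ((border B x c) none) ((border B x c).row '' (some '' Set.univ)) := by
  rw [Set.image_image, Set.image_univ]
  ext z
  simp only [Set.mem_insert_iff, Set.mem_range, Option.exists]
  exact or_congr ⟨fun h => h.symm, fun h => h.symm⟩ Iff.rfl

theorem isSymm_border {R V : Type*} {B : Matrix V V R} {x : V → R} {c : R} :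
    (border B x c).IsSymm ↔ B.IsSymm := by
  simp only [Matrix.IsSymm.ext_iff, Option.forall, border_none_none, border_none_some,
    border_some_none, border_some_some, true_and, implies_true]

variable {K : Type*} [Field K] {V W : Type*}

theorem finrank_span_insert_of_notMem {M : Type*} [AddCommGroup M] [Module K M]
    [FiniteDimensional K M] {s : Set M} {x : M} (hx : x ∉ span K s) :
    finrank K (span K (insert x s)) = finrank K (span K s) + 1 := by
  have h0 : x ≠ 0 := fun h => hx (h ▸ zero_mem _)
  have hd : (K ∙ x) ⊓ span K s = ⊥ :=
    ((Submodule.disjoint_span_singleton' h0).2 hx).symm.eq_bot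
  have h := Submodule.finrank_sup_add_finrank_inf_eq (K ∙ x) (span K s)
  rw [hd, finrank_bot, finrank_span_singleton h0] at h
  rw [span_insert]
  omega

/-- The rank of the rows of `B` indexed by `A`. -/
def rowRank (A : Set V) (B : Matrix V W K) : ℕ := finrank K (span K (B.row '' A))

theorem rowRank_univ [Finite V] [Fintype W] (B : Matrix V W K) :
    rowRank Set.univ B = B.rank := by
  rw [rowRank, Set.image_univ, B.rank_eq_finrank_span_row]

theorem rowRank_mono [Finite W] {A A' : Set V} (h : A ⊆ A') (B : Matrix V W K) :
    rowRank A B ≤ rowRank A' B :=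
  Submodule.finrank_mono (span_mono (Set.image_mono h))

theorem rowRank_le_rank [Finite V] [Fintype W] (A : Set V) (B : Matrix V W K) :
    rowRank A B ≤ B.rank :=
  rowRank_univ B ▸ rowRank_mono (Set.subset_univ A) B

theorem rowRank_le_ncard [Finite V] (A : Set V) (B : Matrix V W K) :
    rowRank A B ≤ A.ncard := by
  classical
  cases nonempty_fintype V
  have h := finrank_span_le_card (R := K) (B.row '' A)
  rw [Set.toFinset_card, ← Nat.card_eq_fintype_card, Nat.card_coe_set_eq] at h
  exact h.trans (Set.ncard_image_le)

theorem rowRank_eq_rank_submatrix [Finite V] [Fintype W] (A : Set V) (B : Matrix V W K) :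
    rowRank A B = (B.submatrix ((↑) : A → V) id).rank := by
  have h : B.row '' A = Set.range (B.submatrix ((↑) : A → V) id).row := by
    rw [Set.image_eq_range]
    rfl
  rw [Matrix.rank_eq_finrank_span_row, rowRank, h]

/-- If `φ` is injective and maps the rows of `B` to those of `C`, the row ranks agree. -/
theorem rowRank_eq_of_map {V' W' : Type*} {A : Set V} {A' : Set V'} {B : Matrix V W K}
    {C : Matrix V' W' K} (φ : (W → K) →ₗ[K] (W' → K)) (hφ : Function.Injective φ)
    (h : C.row '' A' = (fun v => φ (B v)) '' A) : rowRank A' C = rowRank A B := by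
  have h' : C.row '' A' = φ '' (B.row '' A) := by rw [h, Set.image_image]; rfl
  rw [rowRank, h', span_image, rowRank]
  exact (LinearEquiv.finrank_eq (Submodule.equivMapOfInjective φ hφ _)).symm

variable [Fintype V]

/-- The injection `b ↦ (b ⬝ᵥ y, b)`. -/
def consDot (y : V → K) : (V → K) →ₗ[K] (Option V → K) where
  toFun b := fun i => i.elim (b ⬝ᵥ y) b
  map_add' a b := by ext (_ | _) <;> simp [add_dotProduct]
  map_smul' a b := by ext (_ | _) <;> simp

theorem consDot_injective (y : V → K) : Function.Injective (consDot y) := fun a b h => by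
  ext v
  exact congrFun h (some v)

/-- On `A` the new coordinate is one linear functional of the old row, so the extended rows are the
images of the old ones under the injection `consDot y`. -/
theorem rowRank_border {A : Set V} {B : Matrix V V K} {x y : V → K} (c : K)
    (h : ∀ v ∈ A, x v = B v ⬝ᵥ y) : rowRank (some '' A) (border B x c) = rowRank A B := by
  refine rowRank_eq_of_map (consDot y) (consDot_injective y) ?_
  rw [Set.image_image]
  refine Set.image_congr fun v hv => ?_
  ext (_ | w)
  · exact h v hv
  · rfl

theorem mem_span_row_iff {B : Matrix V V K} (hB : B.IsSymm) (x : V → K) :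
    x ∈ span K (B.row '' Set.univ) ↔ ∃ y, B.mulVec y = x := by
  have : B.row '' Set.univ = Set.range B.col := by
    rw [Set.image_univ]
    congr 1
    ext v w
    exact hB.apply w v
  rw [this, ← Matrix.range_mulVecLin]
  rfl

/-- The new row is `consDot y x`, and `x` lies in the row space because `B` is symmetric. -/
theorem rank_border_of_eq {B : Matrix V V K} (hB : B.IsSymm) {x y : V → K} {c : K}
    (hx : B.mulVec y = x) (hc : c = x ⬝ᵥ y) : (border B x c).rank = B.rank := by
  have hV : rowRank (some '' Set.univ) (border B x c) = B.rank := by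
    rw [← rowRank_univ]
    exact rowRank_border c fun v _ => by rw [← hx]; rfl
  rw [Matrix.rank_eq_finrank_span_row, range_row_border, ← hV, rowRank, span_insert_eq_span]
  have h1 : border B x c none = consDot y x := by
    ext (_ | v)
    · exact hc
    · rfl
  have h2 : (border B x c).row '' (some '' Set.univ) = consDot y '' (B.row '' Set.univ) := by
    simp only [Set.image_image]
    refine Set.image_congr fun v _ => ?_
    ext (_ | w)
    · change x v = _
      rw [← hx]; rfl
    · rfl
  rw [h1, h2, span_image]
  exact mem_map_of_mem ((mem_span_row_iff hB x).2 ⟨y, hx⟩)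

/-- The old rows span a subspace of the graph of `b ↦ b ⬝ᵥ y`; the new row `(c, x)` is off this
graph. -/
theorem rank_border_of_ne {B : Matrix V V K} {x y : V → K} {c : K}
    (hx : B.mulVec y = x) (hc : c ≠ x ⬝ᵥ y) : (border B x c).rank = B.rank + 1 := by
  have hV : rowRank (some '' Set.univ) (border B x c) = B.rank := by
    rw [← rowRank_univ]
    exact rowRank_border c fun v _ => by rw [← hx]; rfl
  rw [Matrix.rank_eq_finrank_span_row, range_row_border, ← hV, rowRank,
    finrank_span_insert_of_notMem]
  have h2 : (border B x c).row '' (some '' Set.univ) = consDot y '' (B.row '' Set.univ) := by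
    simp only [Set.image_image]
    refine Set.image_congr fun v _ => ?_
    ext (_ | w)
    · change x v = _
      rw [← hx]; rfl
    · rfl
  rw [h2, span_image]
  rintro ⟨b, -, hb⟩
  have hbx : b = x := by
    ext v
    exact congrFun hb (some v)
  subst hbx
  exact hc (congrFun hb none).symm

/-- Seen by columns: without the new row, the matrix has the columns of `B` and the independent
column `x`. -/
theorem rowRank_border_of_notMem {B : Matrix V V K} {x : V → K} (c : K)
    (hx : ¬ ∃ y, B.mulVec y = x) :
    rowRank (some '' Set.univ) (border B x c) = B.rank + 1 := by
  have h1 : rowRank (some '' Set.univ) (border B x c) =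
      ((border B x c).submatrix some id).rank := by
    have h : (border B x c).row '' (some '' Set.univ) =
        Set.range ((border B x c).submatrix some id).row := by
      rw [Set.image_image, Set.image_univ]
      rfl
    rw [Matrix.rank_eq_finrank_span_row, rowRank, h]
  have h2 : Set.range ((border B x c).submatrix some id).col = insert x (Set.range B.col) := by
    ext z
    simp only [Set.mem_range, Set.mem_insert_iff, Option.exists]
    exact or_congr ⟨fun h => h.symm, fun h => h.symm⟩ Iff.rfl
  rw [h1, Matrix.rank_eq_finrank_span_cols, h2, finrank_span_insert_of_notMem,
    Matrix.rank_eq_finrank_span_cols]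
  rw [← Matrix.range_mulVecLin]
  exact hx

/-- The new column gives one unit of rank and the new row another: were that row dependent,
forgetting the new coordinate would put `x` in the row space, which by symmetry is the column space.
-/
theorem rank_border_of_notMem {B : Matrix V V K} (hB : B.IsSymm) {x : V → K} (c : K)
    (hx : ¬ ∃ y, B.mulVec y = x) : (border B x c).rank = B.rank + 2 := by
  rw [Matrix.rank_eq_finrank_span_row, range_row_border, finrank_span_insert_of_notMem]
  · exact congrArg (· + 1) (rowRank_border_of_notMem c hx)
  intro h
  refine hx ((mem_span_row_iff hB x).1 ?_)
  have h' := mem_map_of_mem (f := LinearMap.funLeft K K (some : V → Option V)) h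
  rw [← span_image, Set.image_image, Set.image_image] at h'
  exact h'

/-- The number of vectors in the column space of `B` that vanish on `A`. -/
theorem card_range_mulVec_vanishing [Finite K] (A : Set V) (B : Matrix V V K) :
    Nat.card {x : V → K // (∀ v ∈ A, x v = 0) ∧ ∃ y, B.mulVec y = x} =
      Nat.card K ^ (B.rank - rowRank A B) := by
  let f : LinearMap.range B.mulVecLin →ₗ[K] (A → K) :=
    (LinearMap.funLeft K K ((↑) : A → V)).domRestrict _
  -- Restricting the column space to the coordinates in `A` gives the column space of the submatrix
  -- with rows `A`; the vectors to be counted form the kernel.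
  have hr : finrank K (LinearMap.range f) = rowRank A B := by
    rw [rowRank_eq_rank_submatrix, Matrix.rank]
    suffices h : LinearMap.range f =
        LinearMap.range (B.submatrix ((↑) : A → V) id).mulVecLin by rw [h]
    ext z
    constructor
    · rintro ⟨⟨_, y, rfl⟩, rfl⟩
      exact ⟨y, rfl⟩
    · rintro ⟨y, rfl⟩
      exact ⟨⟨_, y, rfl⟩, rfl⟩
  have hk := f.finrank_range_add_finrank_ker
  rw [hr, ← Matrix.rank] at hk
  rw [← hk, Nat.add_sub_cancel_left, ← Module.natCard_eq_pow_finrank (K := K) (V := LinearMap.ker f)]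
  refine Nat.card_congr
    { toFun := fun x => ⟨⟨x.1, x.2.2⟩, ?_⟩
      invFun := fun x => ⟨x.1.1, ?_, x.1.2⟩
      left_inv := fun x => rfl
      right_inv := fun x => rfl }
  · ext v
    exact x.2.1 v v.2
  · intro v hv
    exact congrFun (LinearMap.mem_ker.1 x.2) ⟨v, hv⟩

theorem card_vanishing [Finite K] (A : Set V) :
    Nat.card {x : V → K // ∀ v ∈ A, x v = 0} = Nat.card K ^ (Fintype.card V - A.ncard) := by
  classical
  cases nonempty_fintype K
  have e : {x : V → K // ∀ v ∈ A, x v = 0} ≃ ((Aᶜ : Set V) → K) :=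
    { toFun := fun x v => x.1 v
      invFun := fun x => ⟨fun v => if h : v ∈ A then 0 else x ⟨v, h⟩, fun v hv => by simp [hv]⟩
      left_inv := fun x => by
        ext v
        by_cases hv : v ∈ A
        · simp [hv, x.2 v hv]
        · simp [hv]
      right_inv := fun x => by
        ext v
        have hv : (v : V) ∉ A := v.2
        simp [hv] }
  rw [Nat.card_congr e, Nat.card_fun, Nat.card_coe_set_eq, Set.ncard_compl,
    Nat.card_eq_fintype_card (α := V)]

end Border

/-! ### Counting symmetric matrices with prescribed zeros -/

section Counting

variable {V : Type*} {K : Type*} [Field K]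

/-- The symmetric matrices that vanish on the edges of `G`. -/
abbrev GraphSymm (G : SimpleGraph V) (K : Type*) [Field K] : Type _ :=
  {B : Matrix V V K // B.IsSymm ∧ ∀ v w, G.Adj v w → B v w = 0}

instance [Finite V] [Finite K] (G : SimpleGraph V) : Fintype (GraphSymm G K) :=
  have : Finite (Matrix V V K) := inferInstanceAs (Finite (V → V → K))
  Fintype.ofFinite _

/-- The graph `G` with a new vertex, adjacent to the vertices in `A`. -/
def addVertex (G : SimpleGraph V) (A : Set V) : SimpleGraph (Option V) where
  Adj i j := i.elim (j.elim False (· ∈ A)) fun v => j.elim (v ∈ A) (G.Adj v)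
  symm := ⟨by rintro (_ | v) (_ | w) h <;> first | exact h | exact h.symm⟩
  loopless := ⟨by rintro (_ | v) h <;> first | exact h | exact G.loopless.irrefl v h⟩

/-- A symmetric matrix for `addVertex G A` is a bordered symmetric matrix for `G`. -/
def borderEquiv (G : SimpleGraph V) (A : Set V) :
    GraphSymm G K × {x : V → K // ∀ v ∈ A, x v = 0} × K ≃ GraphSymm (addVertex G A) K where
  toFun p := ⟨border p.1.1 p.2.1.1 p.2.2, isSymm_border.2 p.1.2.1, by
    rintro (_ | v) (_ | w) h
    · exact h.elim
    · exact p.2.1.2 w h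
    · exact p.2.1.2 v h
    · exact p.1.2.2 v w h⟩
  invFun B := (⟨B.1.submatrix some some, B.2.1.submatrix _, fun v w h => B.2.2 (some v) (some w) h⟩,
    ⟨fun v => B.1 none (some v), fun v hv => B.2.2 none (some v) hv⟩, B.1 none none)
  left_inv p := rfl
  right_inv B := by
    ext (_ | v) (_ | w)
    · rfl
    · rfl
    · exact B.2.1.apply (some v) none
    · rfl

/-- The defect `|A| - rk A` of the rows of `B` indexed by `A`. -/
def defect (A : Set V) (B : Matrix V V K) : ℕ := A.ncard - rowRank A B

variable [Fintype V]

theorem defect_border {A : Set V} {B : Matrix V V K} {x : V → K} (c : K)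
    (hx : ∀ v ∈ A, x v = 0) : defect (some '' A) (border B x c) = defect A B := by
  rw [defect, defect, rowRank_border (y := 0) c fun v hv => by rw [hx v hv, dotProduct_zero],
    Set.ncard_image_of_injective _ (Option.some_injective V)]

theorem sum_rank_border_snd [Fintype K] {B : Matrix V V K} (hB : B.IsSymm) (g : ℕ → ℚ)
    (x : V → K) [Decidable (∃ y, B.mulVec y = x)] :
    ∑ c, g (border B x c).rank = if ∃ y, B.mulVec y = x then
      g B.rank + ((Nat.card K : ℚ) - 1) * g (B.rank + 1) else Nat.card K * g (B.rank + 2) := by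
  classical
  split_ifs with h
  · obtain ⟨y, hy⟩ := h
    rw [← Finset.add_sum_erase _ _ (Finset.mem_univ (x ⬝ᵥ y)), rank_border_of_eq hB hy rfl,
      Finset.sum_congr rfl fun c hc => by
        rw [rank_border_of_ne hy (Finset.ne_of_mem_erase hc)],
      Finset.sum_const, Finset.card_erase_of_mem (Finset.mem_univ _), Finset.card_univ,
      nsmul_eq_mul, Nat.card_eq_fintype_card, Nat.cast_sub Fintype.card_pos, Nat.cast_one]
  · rw [Finset.sum_congr rfl fun c _ => by rw [rank_border_of_notMem hB c h],
      Finset.sum_const, Finset.card_univ, nsmul_eq_mul, Nat.card_eq_fintype_card]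

/-- The factor `q ^ |A|` turns the exponent `rank B - rk A` of the number of good `x` into `rank B +
defect A B`. -/
theorem sum_rank_border [Fintype K] (A : Set V) {B : Matrix V V K} (hB : B.IsSymm)
    [Fintype {x : V → K // ∀ v ∈ A, x v = 0}] (g : ℕ → ℚ) :
    (Nat.card K : ℚ) ^ A.ncard *
        ∑ x : {x : V → K // ∀ v ∈ A, x v = 0}, ∑ c, g (border B x.1 c).rank =
      (Nat.card K : ℚ) ^ (B.rank + defect A B) *
        (g B.rank + ((Nat.card K : ℚ) - 1) * g (B.rank + 1)) +
      ((Nat.card K : ℚ) ^ Fintype.card V - (Nat.card K : ℚ) ^ (B.rank + defect A B)) *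
        (Nat.card K * g (B.rank + 2)) := by
  classical
  have hq : (Nat.card K : ℚ) ≠ 0 := by exact_mod_cast Nat.card_pos.ne'
  have h1 : ((Finset.univ.filter fun x : {x : V → K // ∀ v ∈ A, x v = 0} =>
      ∃ y, B.mulVec y = x.1).card : ℚ) = (Nat.card K : ℚ) ^ (B.rank - rowRank A B) := by
    rw [← Fintype.card_subtype, ← Nat.card_eq_fintype_card]
    exact_mod_cast (Nat.card_congr (Equiv.subtypeSubtypeEquivSubtypeInter _ _)).trans
      (card_range_mulVec_vanishing A B)
  have h2 : ((Finset.univ.filter fun x : {x : V → K // ∀ v ∈ A, x v = 0} =>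
      ¬ ∃ y, B.mulVec y = x.1).card : ℚ) =
      (Nat.card K : ℚ) ^ (Fintype.card V - A.ncard) -
        (Nat.card K : ℚ) ^ (B.rank - rowRank A B) := by
    rw [eq_sub_iff_add_eq, add_comm, ← h1, ← Nat.cast_add,
      Finset.card_filter_add_card_filter_not, Finset.card_univ, ← Nat.card_eq_fintype_card,
      card_vanishing, Nat.cast_pow]
  have h3 : A.ncard ≤ Fintype.card V := by
    rw [← Nat.card_eq_fintype_card]; exact Set.ncard_le_card A
  have h4 := rowRank_le_ncard A B
  have h5 := rowRank_le_rank A B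
  have e1 : (Nat.card K : ℚ) ^ (B.rank + defect A B) =
      (Nat.card K : ℚ) ^ A.ncard * (Nat.card K : ℚ) ^ (B.rank - rowRank A B) := by
    rw [← pow_add, defect]; congr 1; omega
  have e2 : (Nat.card K : ℚ) ^ Fintype.card V =
      (Nat.card K : ℚ) ^ A.ncard * (Nat.card K : ℚ) ^ (Fintype.card V - A.ncard) := by
    rw [← pow_add]; congr 1; omega
  rw [Finset.sum_congr rfl fun x _ => sum_rank_border_snd hB g x.1, Finset.sum_ite,
    Finset.sum_const, Finset.sum_const, nsmul_eq_mul, nsmul_eq_mul, h1, h2, e1, e2]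
  ring

theorem sum_addVertex [Fintype K] (G : SimpleGraph V) (A : Set V)
    [Fintype {x : V → K // ∀ v ∈ A, x v = 0}] (F : Matrix (Option V) (Option V) K → ℚ) :
    ∑ B : GraphSymm (addVertex G A) K, F B.1 = ∑ B : GraphSymm G K,
      ∑ x : {x : V → K // ∀ v ∈ A, x v = 0}, ∑ c, F (border B.1 x.1 c) := by
  rw [← (borderEquiv G A).sum_comp, Fintype.sum_prod_type]
  simp only [Fintype.sum_prod_type]
  rfl

/-- Effect of a new vertex adjacent to `A` on the count of matrices weighted by their rank and by
the defect of `A`. -/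
theorem sum_addVertex_rank_defect [Fintype K] (G : SimpleGraph V) (A : Set V) (g : ℕ → ℚ) (k : ℕ) :
    (Nat.card K : ℚ) ^ A.ncard * ∑ B : GraphSymm (addVertex G A) K,
        g B.1.rank * (Nat.card K : ℚ) ^ (k * defect (some '' A) B.1) =
      ∑ B : GraphSymm G K, ((Nat.card K : ℚ) ^ (B.1.rank + (k + 1) * defect A B.1) *
        (g B.1.rank + ((Nat.card K : ℚ) - 1) * g (B.1.rank + 1)) +
      ((Nat.card K : ℚ) ^ (Fintype.card V + k * defect A B.1) -
        (Nat.card K : ℚ) ^ (B.1.rank + (k + 1) * defect A B.1)) *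
        (Nat.card K * g (B.1.rank + 2))) := by
  classical
  rw [sum_addVertex G A fun B => g B.rank * (Nat.card K : ℚ) ^ (k * defect (some '' A) B),
    Finset.mul_sum]
  refine Finset.sum_congr rfl fun B _ => ?_
  have h : ∀ x : {x : V → K // ∀ v ∈ A, x v = 0}, ∀ c, defect (some '' A) (border B.1 x.1 c) =
      defect A B.1 := fun x c => defect_border c x.2
  simp only [h, ← Finset.sum_mul]
  rw [← mul_assoc, sum_rank_border A B.2.1 g]
  ring

/-- The conditions that `B` and its rows indexed by `T` have rank `s`, and that the rows of `B`
indexed by `A` have rank `ρ` for all pairs `(A, ρ)` in the list `L`. -/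
def RankCond (s : ℕ) (T : Set V) (L : List (Set V × ℕ)) (B : Matrix V V K) : Prop :=
  B.rank = s ∧ rowRank T B = s ∧ ∀ p ∈ L, rowRank p.1 B = p.2

/-- The list of conditions `L`, for the vertices of `G` regarded as vertices of `addVertex G A`. -/
def liftCond (L : List (Set V × ℕ)) : List (Set (Option V) × ℕ) :=
  L.map fun p => (some '' p.1, p.2)

/-- The bordered rank must be attained on old rows. For `x` outside the column space these have rank
only `B.rank + 1`, against `B.rank + 2` in total; for `x` inside, their ranks are unchanged, so the
total cannot rise. -/
theorem rankCond_border {s : ℕ} {T : Set V} {L : List (Set V × ℕ)} {B : Matrix V V K}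
    (hB : B.IsSymm) (x : V → K) (c : K) :
    RankCond s (some '' T) (liftCond L) (border B x c) ↔
      (border B x c).rank = B.rank ∧ RankCond s T L B := by
  by_cases hx : ∃ y, B.mulVec y = x
  · obtain ⟨y, hy⟩ := hx
    have h : ∀ A : Set V, rowRank (some '' A) (border B x c) = rowRank A B := fun A =>
      rowRank_border c fun v _ => by rw [← hy]; rfl
    have hu := h Set.univ
    rw [rowRank_univ] at hu
    simp only [RankCond, liftCond, List.forall_mem_map, h]
    constructor
    · rintro ⟨h1, h2, h3⟩
      have h4 := rowRank_le_rank T B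
      have h5 := rowRank_le_rank (some '' Set.univ) (border B x c)
      exact ⟨by omega, by omega, h2, h3⟩
    · rintro ⟨h1, h2, h3⟩
      exact ⟨h1.trans h2, h3⟩
  · have h1 := rank_border_of_notMem hB c hx
    have h2 := rowRank_border_of_notMem c hx
    constructor
    · rintro ⟨h3, h4, -⟩
      have := rowRank_mono (Set.image_mono (f := some) (Set.subset_univ T)) (border B x c)
      omega
    · rintro ⟨h3, -⟩
      omega

-- Only the borders preserving the rank survive, so no terms of other ranks appear in the recursion
-- and the conditions `L` persist.
open Classical in
theorem sum_addVertex_rankCond [Fintype K] (G : SimpleGraph V) (A : Set V) (s : ℕ) (T : Set V)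
    (L : List (Set V × ℕ)) (k : ℕ) :
    (Nat.card K : ℚ) ^ A.ncard * ∑ B : GraphSymm (addVertex G A) K,
        (if RankCond s (some '' T) (liftCond L) B.1 then 1 else 0) *
          (Nat.card K : ℚ) ^ (k * defect (some '' A) B.1) =
      (Nat.card K : ℚ) ^ s * ∑ B : GraphSymm G K, (if RankCond s T L B.1 then 1 else 0) *
        (Nat.card K : ℚ) ^ ((k + 1) * defect A B.1) := by
  rw [sum_addVertex G A fun B => (if RankCond s (some '' T) (liftCond L) B then 1 else 0) *
    (Nat.card K : ℚ) ^ (k * defect (some '' A) B), Finset.mul_sum, Finset.mul_sum]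
  refine Finset.sum_congr rfl fun B _ => ?_
  have h : ∀ x : {x : V → K // ∀ v ∈ A, x v = 0}, ∀ c, defect (some '' A) (border B.1 x.1 c) =
      defect A B.1 := fun x c => defect_border c x.2
  simp only [h, ← Finset.sum_mul, rankCond_border B.2.1]
  by_cases hB : RankCond s T L B.1
  · simp only [hB, and_true, if_true]
    rw [← mul_assoc, sum_rank_border A B.2.1 fun r => if r = B.1.rank then 1 else 0]
    simp only [if_true, Nat.add_eq_left, one_ne_zero, OfNat.ofNat_ne_zero, if_false, hB.1]
    ring
  · simp [hB]

end Counting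

/-! ### Points of schemes with values in a field -/

section Points

open CategoryTheory

variable {K : Type} [Field K]

/-- Points of `Spec (ℤ[x] / (S))` are the zeros of `S`. -/
def quotientPoints {σ : Type} (S : Set (MvPolynomial σ ℤ)) (K : Type) [Field K] :
    (MvPolynomial σ ℤ ⧸ Ideal.span S →+* K) ≃
      {x : σ → K // ∀ f ∈ S, MvPolynomial.eval₂Hom (Int.castRingHom K) x f = 0} where
  toFun φ := ⟨fun i => φ (Ideal.Quotient.mk _ (MvPolynomial.X i)), fun f hf => by
    have : MvPolynomial.eval₂Hom (Int.castRingHom K)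
        (fun i => φ (Ideal.Quotient.mk (Ideal.span S) (MvPolynomial.X i))) =
        φ.comp (Ideal.Quotient.mk (Ideal.span S)) := by
      ext <;> simp
    rw [this, RingHom.comp_apply, Ideal.Quotient.eq_zero_iff_mem.2 (Ideal.subset_span hf),
      map_zero]⟩
  invFun x := Ideal.Quotient.lift _ (MvPolynomial.eval₂Hom (Int.castRingHom K) x.1) fun f hf =>
    RingHom.mem_ker.1 ((Ideal.span_le (I := RingHom.ker _)).2 (fun g hg => x.2 g hg) hf)
  left_inv φ := by
    ext <;> simp
  right_inv x := by
    ext; simp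

/-- Points of `Spec (ℤ[x] / (S))` with an additional property. -/
def quotientPointsSubtype {σ : Type} (S : Set (MvPolynomial σ ℤ)) (K : Type) [Field K]
    (P : (σ → K) → Prop) :
    {φ : MvPolynomial σ ℤ ⧸ Ideal.span S →+* K // P (quotientPoints S K φ).1} ≃
      {x : σ → K // (∀ f ∈ S, MvPolynomial.eval₂Hom (Int.castRingHom K) x f = 0) ∧ P x} :=
  ((quotientPoints S K).subtypeEquiv (q := fun x => P x.1) fun _ => Iff.rfl).trans
    (Equiv.subtypeSubtypeEquivSubtypeInter
      (fun x => ∀ f ∈ S, MvPolynomial.eval₂Hom (Int.castRingHom K) x f = 0) P)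

theorem quotientPoints_eval {σ : Type} (S : Set (MvPolynomial σ ℤ))
    (φ : MvPolynomial σ ℤ ⧸ Ideal.span S →+* K) (f : MvPolynomial σ ℤ) :
    φ (Ideal.Quotient.mk _ f) =
      MvPolynomial.eval₂Hom (Int.castRingHom K) (quotientPoints S K φ).1 f := by
  obtain ⟨x, rfl⟩ := (quotientPoints S K).symm.surjective φ
  rw [Equiv.apply_symm_apply]
  exact Ideal.Quotient.lift_mk _ _ _

theorem eval₂Hom_det {σ n : Type} [Fintype n] [DecidableEq n] (x : σ → K) (i : n → n → σ) :
    MvPolynomial.eval₂Hom (Int.castRingHom K) x (Matrix.det (Matrix.of fun a b =>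
      (MvPolynomial.X (i a b) : MvPolynomial σ ℤ))) = Matrix.det (Matrix.of fun a b => x (i a b)) := by
  rw [RingHom.map_det]
  congr 1
  ext a b
  simp

/-- Points of the basic open `D(d)`. -/
def awayPoints {A : Type} [CommRing A] (d : A) (K : Type) [Field K] :
    (Localization.Away d →+* K) ≃ {φ : A →+* K // φ d ≠ 0} where
  toFun φ := ⟨φ.comp (algebraMap A _),
    ((IsLocalization.Away.algebraMap_isUnit (S := Localization.Away d) d).map φ).ne_zero⟩
  invFun φ := IsLocalization.Away.lift d (isUnit_iff_ne_zero.2 φ.2)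
  left_inv _ := IsLocalization.ringHom_ext (Submonoid.powers d)
    (IsLocalization.Away.lift_comp d _)
  right_inv _ := Subtype.ext (IsLocalization.Away.lift_comp d _)

/-- Morphisms `Spec K ⟶ Spec A` are ring homomorphisms `A → K`. -/
def specPoints (A : Type) [CommRing A] (K : Type) [Field K] :
    (Spec (CommRingCat.of K) ⟶ Spec (CommRingCat.of A)) ≃ (A →+* K) where
  toFun f := (Spec.preimage f).hom
  invFun φ := Spec.map (CommRingCat.ofHom φ)
  left_inv f := Spec.map_preimage f
  right_inv φ := congrArg CommRingCat.Hom.hom (Spec.preimage_map (CommRingCat.ofHom φ))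

/-- Points of an open subscheme. -/
def openPoints {Y : Scheme.{0}} (U : Y.Opens) (S : Scheme.{0}) :
    (S ⟶ U.toScheme) ≃ {f : S ⟶ Y // ∀ x, f x ∈ U} where
  toFun f := ⟨f ≫ U.ι, fun x => by
    rw [Scheme.Hom.comp_apply]
    exact (f x).2⟩
  invFun f := IsOpenImmersion.lift U.ι f.1 (by
    rw [U.range_ι]
    rintro _ ⟨x, rfl⟩
    exact f.2 x)
  left_inv f := ((IsOpenImmersion.lift_uniq _ _ _ _) rfl).symm
  right_inv f := Subtype.ext (IsOpenImmersion.lift_fac _ _ _)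

theorem mem_iInf_iSup_basicOpen {A ι : Type*} {κ : ι → Type*} [CommRing A] [Finite ι]
    (a : ∀ i, κ i → A) (p : PrimeSpectrum A) :
    p ∈ (⨅ i, ⨆ k, PrimeSpectrum.basicOpen (a i k) : TopologicalSpace.Opens _) ↔
      ∀ i, ∃ k, a i k ∉ p.asIdeal := by
  rw [← SetLike.mem_coe, TopologicalSpace.Opens.coe_iInf, Set.mem_iInter]
  refine forall_congr' fun i => ?_
  rw [SetLike.mem_coe, TopologicalSpace.Opens.mem_iSup]
  rfl

theorem mem_asIdeal_specPoints_symm {A : Type} [CommRing A] (φ : A →+* K) (a : A)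
    (x : Spec (CommRingCat.of K)) :
    a ∈ ((specPoints A K).symm φ x).asIdeal ↔ φ a = 0 := by
  have hx : x.asIdeal = (⊥ : Ideal K) := (eq_bot_or_eq_top _).resolve_right x.isPrime.ne_top
  change φ a ∈ x.asIdeal ↔ _
  exact (SetLike.ext_iff.1 hx (φ a)).trans Ideal.mem_bot

end Points

/-! ### Rank in terms of nonvanishing minors. -/

section Minors

variable {K : Type*} [Field K]

theorem exists_linearIndependent_rows {m n : Type*} [Finite m] [Fintype n] (B : Matrix m n K)
    {k : ℕ} (hk : k ≤ B.rank) :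
    ∃ a : Fin k ↪ m, LinearIndependent K fun i => B (a i) := by
  obtain ⟨κ, a, ha, hs, hl⟩ := exists_linearIndependent' K B.row
  have : Finite κ := Finite.of_injective a ha
  cases nonempty_fintype κ
  have hc : B.rank = Fintype.card κ := by
    rw [B.rank_eq_finrank_span_row, ← hs, finrank_span_eq_card hl]
  have e : Fin k ↪ κ := (Fin.castLEEmb (hk.trans_eq hc)).trans (Fintype.equivFin κ).symm.toEmbedding
  exact ⟨e.trans ⟨a, ha⟩, hl.comp e e.injective⟩

/-- The rank of the rows in `A` is at least `k` if and only if some `k × k` minor with rows in `A`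
does not vanish. -/
theorem le_rowRank_iff_exists_minor {E n : Type*} [Finite E] [Fintype n] (F : Matrix E n K)
    (A : Set E) (k : ℕ) : k ≤ rowRank A F ↔ ∃ (a : Fin k ↪ E) (b : Fin k ↪ n), (∀ i, a i ∈ A) ∧
      Matrix.det (Matrix.of fun i j => F (a i) (b j)) ≠ 0 := by
  rw [rowRank_eq_rank_submatrix]
  constructor
  · intro hk
    obtain ⟨a, ha⟩ := exists_linearIndependent_rows _ hk
    -- The chosen `k` rows have rank `k`; transposing, `k` independent columns are chosen among
    -- them.
    have hr := ha.rank_matrix (M := (F.submatrix ((↑) : A → E) id).submatrix a id)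
    rw [← Matrix.rank_transpose, Fintype.card_fin] at hr
    obtain ⟨b, hb⟩ := exists_linearIndependent_rows _ hr.ge
    refine ⟨a.trans (Function.Embedding.subtype _), b, fun i => (a i).2, ?_⟩
    have hu := (Matrix.isUnit_iff_isUnit_det _).1
      (Matrix.linearIndependent_rows_iff_isUnit.1 hb)
    rw [← Matrix.det_transpose]
    exact hu.ne_zero
  · rintro ⟨a, b, ha, hd⟩
    have h := Matrix.rank_of_det_ne_zero hd
    rw [Fintype.card_fin] at h
    rw [← h]
    exact Matrix.rank_submatrix_le (F.submatrix ((↑) : A → E) id) (fun i => ⟨a i, ha i⟩) b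

end Minors

/-! ### Point counts over `𝔽_q` -/

instance (q : PrimePower) : Finite (Fq q) := by
  unfold Fq; infer_instance

instance (q : PrimePower) : Fintype (Fq q) := Fintype.ofFinite _

theorem card_Fq (q : PrimePower) : Nat.card (Fq q) = q.1 := by
  rw [GaloisField.card, q.2.minFac_pow_factorization_eq]
  exact (Nat.Prime.factorization_pos_of_dvd (Nat.minFac_prime q.2.ne_one) q.2.ne_zero
    (Nat.minFac_dvd _)).ne'

theorem rank_eq_card_iff {K V : Type*} [Field K] [Fintype V] [DecidableEq V] (B : Matrix V V K) :
    B.rank = Fintype.card V ↔ B.det ≠ 0 := by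
  refine ⟨fun h => ?_, Matrix.rank_of_det_ne_zero⟩
  rw [Matrix.rank_eq_finrank_span_row] at h
  have hl : LinearIndependent K B.row := linearIndependent_iff_card_eq_finrank_span.2 h.symm
  exact ((Matrix.isUnit_iff_isUnit_det _).1 (Matrix.linearIndependent_rows_iff_isUnit.1 hl)).ne_zero

theorem pointCount_ZScheme {V : Type} [Fintype V] (G : SimpleGraph V) (q : PrimePower) :
    pointCount (ZScheme G) q =
      ∑ B : GraphSymm G (Fq q), if B.1.rank = Fintype.card V then 1 else 0 := by
  classical
  rw [Finset.sum_boole, ← Fintype.card_subtype, ← Nat.card_eq_fintype_card, pointCount]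
  congr 1
  let e : {x : V × V → Fq q // ∀ f ∈ ({f | ∃ v w, f = MvPolynomial.X (v, w) - MvPolynomial.X (w, v)} ∪
      {f | ∃ v w, G.Adj v w ∧ f = MvPolynomial.X (v, w)} : Set (MvPolynomial (V × V) ℤ)),
      MvPolynomial.eval₂Hom (Int.castRingHom _) x f = 0} ≃ GraphSymm G (Fq q) :=
    ((Equiv.curry V V (Fq q)).trans Matrix.of).subtypeEquiv fun x => by
      constructor
      · intro h
        refine ⟨Matrix.IsSymm.ext fun v w => ?_, fun v w hvw => ?_⟩
        · simpa [sub_eq_zero] using h _ (Or.inl ⟨w, v, rfl⟩)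
        · simpa using h _ (Or.inr ⟨v, w, hvw, rfl⟩)
      · rintro ⟨h1, h2⟩ _ (⟨v, w, rfl⟩ | ⟨v, w, hvw, rfl⟩)
        · simpa [sub_eq_zero] using h1.apply w v
        · simpa using h2 v w hvw
  refine Nat.card_congr (((specPoints _ _).trans (awayPoints _ _)).trans
    (((quotientPoints _ _).trans e).subtypeEquiv fun φ => ?_))
  rw [rank_eq_card_iff, symDet]
  refine not_congr (Eq.congr_left ?_)
  exact (quotientPoints_eval _ φ _).trans (eval₂Hom_det _ _)

theorem mem_repOpen {α : Type} {M : Matroid α} [M.Finite] {s : ℕ}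
    {p : Spec (CommRingCat.of (MvPolynomial (M.E × Fin s) ℤ ⧸ repIdeal M s))} :
    p ∈ repOpen M s ↔ ∀ A : Set M.E, ∃ m : minors s A (rankFun M A),
      Ideal.Quotient.mk (repIdeal M s) m.1 ∉ p.asIdeal :=
  have : Finite M.E := M.ground_finite
  mem_iInf_iSup_basicOpen (fun (A : Set M.E) (m : minors s A (rankFun M A)) =>
    Ideal.Quotient.mk (repIdeal M s) m.1) p

theorem eval_minors_iff {E K : Type} [Finite E] [Field K] {s : ℕ} (ρ : Set E → ℕ)
    (x : E × Fin s → K) :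
    ((∀ f ∈ ⋃ A : Set E, minors s A (ρ A + 1),
        MvPolynomial.eval₂Hom (Int.castRingHom K) x f = 0) ∧
      ∀ A : Set E, ∃ m : minors s A (ρ A),
        MvPolynomial.eval₂Hom (Int.castRingHom K) x m.1 ≠ 0) ↔
    ∀ A, rowRank A (Matrix.of (Function.curry x)) = ρ A := by
  simp only [Set.mem_iUnion, forall_exists_index]
  rw [forall_comm, ← forall_and]
  refine forall_congr' fun A => ?_
  rw [le_antisymm_iff, ← not_lt, ← Nat.add_one_le_iff, le_rowRank_iff_exists_minor,
    le_rowRank_iff_exists_minor]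
  refine and_congr ⟨?_, ?_⟩ ⟨?_, ?_⟩
  · rintro h ⟨a, b, ha, hd⟩
    exact hd ((eval₂Hom_det x fun i j => (a i, b j)).symm.trans (h _ ⟨a, b, ha, rfl⟩))
  · rintro h _ ⟨a, b, ha, rfl⟩
    by_contra hd
    exact h ⟨a, b, ha, fun h0 => hd ((eval₂Hom_det x fun i j => (a i, b j)).trans h0)⟩
  · rintro ⟨⟨_, ⟨a, b, ha, rfl⟩⟩, hd⟩
    exact ⟨a, b, ha, fun h0 => hd ((eval₂Hom_det x fun i j => (a i, b j)).trans h0)⟩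
  · rintro ⟨a, b, ha, hd⟩
    exact ⟨⟨_, ⟨a, b, ha, rfl⟩⟩, fun h0 =>
      hd ((eval₂Hom_det x fun i j => (a i, b j)).symm.trans h0)⟩

/-- Points of the representation scheme are matrices with the prescribed ranks of rows. -/
def repPoints {E : Type} [Finite E] (s : ℕ) (ρ : Set E → ℕ) (K : Type) [Field K] :
    {φ : MvPolynomial (E × Fin s) ℤ ⧸
        Ideal.span (⋃ A : Set E, minors s A (ρ A + 1)) →+* K //
      ∀ A : Set E, ∃ m : minors s A (ρ A), φ (Ideal.Quotient.mk _ m.1) ≠ 0} ≃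
    {F : Matrix E (Fin s) K // ∀ A, rowRank A F = ρ A} :=
  (Equiv.subtypeEquivRight fun φ => by simp only [quotientPoints_eval]).trans
    ((quotientPointsSubtype (⋃ A : Set E, minors s A (ρ A + 1)) K fun x => ∀ A : Set E,
      ∃ m : minors s A (ρ A), MvPolynomial.eval₂Hom (Int.castRingHom K) x m.1 ≠ 0).trans
    (((Equiv.curry E (Fin s) K).trans Matrix.of).subtypeEquiv fun x => eval_minors_iff ρ x))

theorem pointCount_repScheme {α : Type} (M : Matroid α) [M.Finite] (s : ℕ) (q : PrimePower) :
    pointCount (repScheme M s) q =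
      Nat.card {F : Matrix M.E (Fin s) (Fq q) // ∀ A, rowRank A F = rankFun M A} := by
  have : Finite M.E := M.ground_finite
  rw [pointCount]
  congr 1
  refine Nat.card_congr ((openPoints _ _).trans
    (((specPoints _ _).subtypeEquiv fun f => ?_).trans (repPoints s (rankFun M) (Fq q))))
  obtain ⟨φ, rfl⟩ := (specPoints _ _).symm.surjective f
  have : Nonempty (Spec (CommRingCat.of (Fq q))) :=
    inferInstanceAs (Nonempty (PrimeSpectrum (Fq q)))
  rw [Equiv.apply_symm_apply]
  exact (forall_congr' fun x => mem_repOpen.trans (forall_congr' fun A => exists_congr fun m =>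
    not_congr (mem_asIdeal_specPoints_symm φ _ x))).trans (forall_const _)

/-! ### Submodules of functions of prime powers -/

theorem smul_eq_evalR_mul (r : R) (φ : PrimePower → ℚ) : r • φ = evalR r * φ := rfl

theorem evalR_algebraMap (p : ℤ[X]) : evalR (algebraMap ℤ[X] R p) = evalPoly p :=
  IsLocalization.lift_eq _ p

theorem evalPoly_mul_mem {N : Submodule R (PrimePower → ℚ)} {φ : PrimePower → ℚ} (p : ℤ[X])
    (h : φ ∈ N) : evalPoly p * φ ∈ N := by
  rw [← evalR_algebraMap, ← smul_eq_evalR_mul]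
  exact N.smul_mem _ h

theorem mem_of_evalPoly_mul_mem {N : Submodule R (PrimePower → ℚ)} {φ : PrimePower → ℚ} {p : ℤ[X]}
    (hp : p ∈ denominators) (h : evalPoly p * φ ∈ N) : φ ∈ N := by
  have h1 := N.smul_mem (IsLocalization.mk' R 1 (⟨p, hp⟩ : denominators)) h
  have h2 : IsLocalization.mk' R 1 (⟨p, hp⟩ : denominators) * algebraMap ℤ[X] R p = 1 := by
    rw [mul_comm, IsLocalization.mul_mk'_eq_mk'_of_mul, mul_one]
    exact IsLocalization.mk'_self R hp
  rwa [← evalR_algebraMap, ← smul_eq_evalR_mul, smul_smul, h2, one_smul] at h1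

theorem mem_denominators_of_dvd {p : ℤ[X]} {n : ℕ} (hn : 1 < n) (h : p ∣ X ^ n - X) :
    p ∈ denominators :=
  Submonoid.mem_saturation_iff_exists_dvd.2
    ⟨_, Submonoid.subset_closure ⟨n, hn, rfl⟩, h⟩

theorem X_pow_mem_denominators (n : ℕ) : (X ^ n : ℤ[X]) ∈ denominators :=
  pow_mem (mem_denominators_of_dvd (n := 2) one_lt_two ⟨X - 1, by ring⟩) n

theorem X_pow_sub_X_pow_mem_denominators {m n : ℕ} (h : m ≠ n) :
    (X ^ m - X ^ n : ℤ[X]) ∈ denominators := by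
  have key : ∀ n d : ℕ, (X ^ n * (X ^ (d + 1) - 1) : ℤ[X]) ∈ denominators := fun n d =>
    mul_mem (X_pow_mem_denominators n)
      (mem_denominators_of_dvd (n := d + 2) (by omega) ⟨X, by ring⟩)
  rcases lt_or_gt_of_ne h with h | h
  · obtain ⟨d, rfl⟩ := Nat.exists_eq_add_of_lt h
    have h1 : (-1 : ℤ[X]) ∈ denominators :=
      mem_denominators_of_dvd one_lt_two (isUnit_one.neg.dvd)
    have := mul_mem h1 (key m d)
    convert this using 1
    ring
  · obtain ⟨d, rfl⟩ := Nat.exists_eq_add_of_lt h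
    convert key n d using 1
    ring

theorem evalPoly_X_pow (n : ℕ) (q : PrimePower) : evalPoly (X ^ n) q = (q.1 : ℚ) ^ n := by
  simp [evalPoly_apply]

/-! ### Division by powers of `q` and their differences, and interpolation. -/

section Membership

variable {N : Submodule R (PrimePower → ℚ)} {φ : PrimePower → ℚ}

theorem pow_mul_mem (n : ℕ) (h : φ ∈ N) : (fun q : PrimePower => (q.1 : ℚ) ^ n * φ q) ∈ N := by
  convert evalPoly_mul_mem (X ^ n) h using 1
  ext q
  rw [Pi.mul_apply, evalPoly_X_pow]

theorem mem_of_pow_mul_mem (n : ℕ) (h : (fun q : PrimePower => (q.1 : ℚ) ^ n * φ q) ∈ N) :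
    φ ∈ N := by
  refine mem_of_evalPoly_mul_mem (X_pow_mem_denominators n) ?_
  convert h using 1
  ext q
  rw [Pi.mul_apply, evalPoly_X_pow]

theorem mem_of_pow_sub_pow_mul_mem {m n : ℕ} (hmn : m ≠ n)
    (h : (fun q : PrimePower => ((q.1 : ℚ) ^ m - (q.1 : ℚ) ^ n) * φ q) ∈ N) : φ ∈ N := by
  refine mem_of_evalPoly_mul_mem (X_pow_sub_X_pow_mem_denominators hmn) ?_
  convert h using 1
  ext q
  rw [Pi.mul_apply, map_sub, Pi.sub_apply, evalPoly_X_pow, evalPoly_X_pow]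

/-- Lagrange interpolation: if all power sums of `q ^ e` with weights `w` lie in `N`, so does the
sum of the weights over a level set of `e`. -/
theorem sum_level_mem {Ω : PrimePower → Type*} [∀ q, Fintype (Ω q)] (w : ∀ q, Ω q → ℚ)
    (e : ∀ q, Ω q → ℕ) (m : ℕ) (he : ∀ q ω, e q ω ≤ m)
    (h : ∀ k : ℕ, (fun q : PrimePower => ∑ ω, w q ω * (q.1 : ℚ) ^ (k * e q ω)) ∈ N) (d : ℕ) :
    (fun q : PrimePower => ∑ ω, w q ω * if e q ω = d then 1 else 0) ∈ N := by
  classical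
  -- Weights polynomial in `q ^ e` are admissible, in particular those vanishing at the nodes `q ^
  -- i`, `i ∈ I`.
  have h1 : ∀ (I : Finset ℕ) (k : ℕ), (fun q : PrimePower => ∑ ω, w q ω *
      (q.1 : ℚ) ^ (k * e q ω) * ∏ i ∈ I, ((q.1 : ℚ) ^ e q ω - (q.1 : ℚ) ^ i)) ∈ N := by
    intro I
    induction I using Finset.induction_on with
    | empty => simpa using h
    | insert i I hi ih =>
      intro k
      convert N.sub_mem (ih (k + 1)) (pow_mul_mem i (ih k)) using 1
      ext q
      rw [Pi.sub_apply, Finset.mul_sum, ← Finset.sum_sub_distrib]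
      refine Finset.sum_congr rfl fun ω _ => ?_
      rw [Finset.prod_insert hi]
      ring
  -- The value of that polynomial at `q ^ d` is a product of elements invertible in `R`.
  have h2 : ∀ I : Finset ℕ, d ∉ I → (fun q : PrimePower =>
      (∏ i ∈ I, ((q.1 : ℚ) ^ d - (q.1 : ℚ) ^ i)) *
        ∑ ω, w q ω * if e q ω = d then 1 else 0) ∈ N →
      (fun q : PrimePower => ∑ ω, w q ω * if e q ω = d then 1 else 0) ∈ N := by
    intro I
    induction I using Finset.induction_on with
    | empty => simp
    | insert i I hi ih =>
      intro hd hI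
      rw [Finset.mem_insert, not_or] at hd
      refine ih hd.2 (mem_of_pow_sub_pow_mul_mem hd.1 ?_)
      simpa only [Finset.prod_insert hi, mul_assoc] using hI
  refine h2 ((Finset.range (m + 1)).erase d) (Finset.notMem_erase _ _) ?_
  convert h1 ((Finset.range (m + 1)).erase d) 0 using 1
  ext q
  rw [Finset.mul_sum]
  refine Finset.sum_congr rfl fun ω _ => ?_
  by_cases hω : e q ω = d
  · rw [hω]; simp [mul_comm]
  · have h0 : ∏ i ∈ (Finset.range (m + 1)).erase d, ((q.1 : ℚ) ^ e q ω - (q.1 : ℚ) ^ i) = 0 :=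
      Finset.prod_eq_zero
        (Finset.mem_erase.2 ⟨hω, Finset.mem_range.2 (Nat.lt_succ_of_le (he q ω))⟩) (sub_self _)
    rw [if_neg hω, h0, mul_zero, mul_zero, mul_zero]

end Membership

/-! ### Counts of symmetric matrices of given rank lie in `graphsStar` -/

/-- The number of symmetric matrices of rank `s` vanishing on the edges of `G`, weighted by the
powers `q ^ (k * defect A)`. -/
def defectSum {V : Type} [Fintype V] (G : SimpleGraph V) (A : Set V) (s k : ℕ) :
    PrimePower → ℚ := fun q =>
  ∑ B : GraphSymm G (Fq q), (if B.1.rank = s then 1 else 0) * (q.1 : ℚ) ^ (k * defect A B.1)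

theorem defectSum_addVertex {V : Type} [Fintype V] (G : SimpleGraph V) (A : Set V) (s k : ℕ)
    (q : PrimePower) :
    (q.1 : ℚ) ^ A.ncard * defectSum (addVertex G A) (some '' A) s k q =
      ∑ B : GraphSymm G (Fq q), ((q.1 : ℚ) ^ (B.1.rank + (k + 1) * defect A B.1) *
        ((if B.1.rank = s then 1 else 0) + ((q.1 : ℚ) - 1) * if B.1.rank + 1 = s then 1 else 0) +
      ((q.1 : ℚ) ^ (Fintype.card V + k * defect A B.1) -
        (q.1 : ℚ) ^ (B.1.rank + (k + 1) * defect A B.1)) *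
        (q.1 * if B.1.rank + 2 = s then 1 else 0)) := by
  have h := sum_addVertex_rank_defect (K := Fq q) G A (fun r => if r = s then 1 else 0) k
  rw [card_Fq] at h
  exact h

theorem defectSum_addVertex_zero {V : Type} [Fintype V] (G : SimpleGraph V) (A : Set V) (k : ℕ)
    (q : PrimePower) :
    (q.1 : ℚ) ^ A.ncard * defectSum (addVertex G A) (some '' A) 0 k q =
      defectSum G A 0 (k + 1) q := by
  rw [defectSum_addVertex]
  simp only [defectSum]
  refine Finset.sum_congr rfl fun B _ => ?_
  by_cases h0 : B.1.rank = 0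
  · simp [h0]
  · simp [h0]

theorem defectSum_addVertex_one {V : Type} [Fintype V] (G : SimpleGraph V) (A : Set V) (k : ℕ)
    (q : PrimePower) :
    (q.1 : ℚ) ^ A.ncard * defectSum (addVertex G A) (some '' A) 1 k q =
      (q.1 : ℚ) ^ 1 * defectSum G A 1 (k + 1) q + (q.1 : ℚ) ^ 1 * defectSum G A 0 (k + 1) q -
      defectSum G A 0 (k + 1) q := by
  rw [defectSum_addVertex]
  simp only [defectSum, Finset.mul_sum, ← Finset.sum_add_distrib, ← Finset.sum_sub_distrib]
  refine Finset.sum_congr rfl fun B _ => ?_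
  generalize B.1.rank = r
  rcases r with _ | _ | r
  · simp; ring
  · simp; ring
  · simp

theorem defectSum_addVertex_add_two {V : Type} [Fintype V] (G : SimpleGraph V) (A : Set V)
    (s k : ℕ) (q : PrimePower) :
    (q.1 : ℚ) ^ A.ncard * defectSum (addVertex G A) (some '' A) (s + 2) k q =
      (q.1 : ℚ) ^ (s + 2) * defectSum G A (s + 2) (k + 1) q +
      (q.1 : ℚ) ^ (s + 2) * defectSum G A (s + 1) (k + 1) q -
      (q.1 : ℚ) ^ (s + 1) * defectSum G A (s + 1) (k + 1) q +
      (q.1 : ℚ) ^ (Fintype.card V + 1) * defectSum G A s k q -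
      (q.1 : ℚ) ^ (s + 1) * defectSum G A s (k + 1) q := by
  rw [defectSum_addVertex]
  simp only [defectSum, Finset.mul_sum, ← Finset.sum_add_distrib, ← Finset.sum_sub_distrib]
  refine Finset.sum_congr rfl fun B _ => ?_
  rcases eq_or_ne B.1.rank (s + 2) with h | h2
  · simp [h]; ring
  rcases eq_or_ne B.1.rank (s + 1) with h | h1
  · simp [h]; ring
  rcases eq_or_ne B.1.rank s with h | h0
  · simp [h]; ring
  · simp [h0, h1, h2]

theorem defectSum_eq_defectSum_zero {V : Type} [Fintype V] (G : SimpleGraph V) (s k : ℕ) :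
    defectSum G ∅ s k = defectSum G ∅ s 0 := by
  ext q
  simp [defectSum, defect]

/-- Induction on a bound `j` for the corank `|V| - s`. In the recursion for an isolated new vertex,
the larger graph with rank `s + 2` and `G` with ranks `s + 1`, `s + 2` all have smaller corank. -/
theorem defectSum_empty_mem {V : Type} [Fintype V] (G : SimpleGraph V) (s : ℕ) :
    defectSum G ∅ s 0 ∈ graphsStar := by
  suffices H : ∀ (j : ℕ) {V : Type} [Fintype V] (G : SimpleGraph V) (s : ℕ),
      Fintype.card V ≤ s + j → defectSum G ∅ s 0 ∈ graphsStar from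
    H (Fintype.card V) G s (by omega)
  intro j
  induction j with
  | zero =>
    intro V _ G s hs
    rcases hs.lt_or_eq with hs | hs
    · convert graphsStar.zero_mem using 1
      ext q
      refine Finset.sum_eq_zero fun B _ => ?_
      have := B.1.rank_le_card_width
      rw [if_neg (by omega), zero_mul]
    · refine Submodule.subset_span ⟨V, inferInstance, G, ?_⟩
      ext q
      rw [pointCount_ZScheme]
      simp [defectSum, hs]
  | succ j ih =>
    intro V _ G s hs
    by_cases hs' : Fintype.card V ≤ s
    · exact ih G s (by omega)
    have h1 := ih (addVertex G ∅) (s + 2) (by rw [Fintype.card_option]; omega)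
    have h2 := ih G (s + 2) (by omega)
    have h3 := ih G (s + 1) (by omega)
    -- The coefficient of the rank `s` count in the recursion; the exponents differ since `s < |V|`.
    refine mem_of_pow_sub_pow_mul_mem (m := Fintype.card V + 1) (n := s + 1) (by omega) ?_
    convert graphsStar.sub_mem (graphsStar.add_mem h1 (pow_mul_mem (s + 1) h3))
      (graphsStar.add_mem (pow_mul_mem (s + 2) h2) (pow_mul_mem (s + 2) h3)) using 1
    ext q
    have h := defectSum_addVertex_add_two G ∅ s 0 q
    rw [Set.image_empty, Set.ncard_empty, pow_zero, one_mul] at h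
    simp only [defectSum_eq_defectSum_zero G _ (0 + 1)] at h
    simp only [Pi.sub_apply, Pi.add_apply, h]
    ring

/-- The recursion is solved for the term of top rank at level `k + 1`: the other terms have level
`k` or lower rank. -/
theorem defectSum_mem {V : Type} [Fintype V] (G : SimpleGraph V) (A : Set V) (s k : ℕ) :
    defectSum G A s k ∈ graphsStar := by
  induction k generalizing V s with
  | zero =>
    convert defectSum_empty_mem G s using 1
    ext q
    simp [defectSum]
  | succ k ih =>
    have h := fun s => pow_mul_mem A.ncard (ih (addVertex G A) (some '' A) s)
    induction s using Nat.strong_induction_on with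
    | _ s ihs =>
      rcases s with _ | _ | s
      · simpa only [defectSum_addVertex_zero] using h 0
      · have h0 := ihs 0 one_pos
        refine mem_of_pow_mul_mem 1 ?_
        convert graphsStar.sub_mem (graphsStar.add_mem (h 1) h0) (pow_mul_mem 1 h0) using 1
        ext q
        simp only [Pi.sub_apply, Pi.add_apply, defectSum_addVertex_one]
        ring
      · have h0 := ihs s (by omega)
        have h1 := ihs (s + 1) (by omega)
        refine mem_of_pow_mul_mem (s + 2) ?_
        convert graphsStar.sub_mem (graphsStar.add_mem (graphsStar.add_mem (h (s + 2))
          (pow_mul_mem (s + 1) h1)) (pow_mul_mem (s + 1) h0))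
          (graphsStar.add_mem (pow_mul_mem (s + 2) h1)
            (pow_mul_mem (Fintype.card V + 1) (ih G A s))) using 1
        ext q
        simp only [Pi.sub_apply, Pi.add_apply, defectSum_addVertex_add_two]
        ring

open Classical in
/-- The number of symmetric matrices vanishing on the edges of `G` and satisfying `RankCond`. -/
def rankCondCount {V : Type} [Fintype V] (G : SimpleGraph V) (s : ℕ) (T : Set V)
    (L : List (Set V × ℕ)) : PrimePower → ℚ := fun q =>
  ∑ B : GraphSymm G (Fq q), if RankCond s T L B.1 then 1 else 0

/-- Interpolation passes from sums weighted by powers of `q ^ defect A` to the condition that the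
rows in `A` have a given rank. -/
theorem sum_rowRank_mem {V : Type} [Fintype V] (G : SimpleGraph V) (A : Set V) (ρ : ℕ)
    (w : ∀ q : PrimePower, Matrix V V (Fq q) → ℚ)
    (h : ∀ k : ℕ, (fun q : PrimePower => ∑ B : GraphSymm G (Fq q),
      w q B.1 * (q.1 : ℚ) ^ (k * defect A B.1)) ∈ graphsStar) :
    (fun q : PrimePower => ∑ B : GraphSymm G (Fq q),
      w q B.1 * if rowRank A B.1 = ρ then 1 else 0) ∈ graphsStar := by
  by_cases hρ : ρ ≤ A.ncard
  · convert sum_level_mem (fun q (B : GraphSymm G (Fq q)) => w q B.1) (fun q B => defect A B.1)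
      A.ncard (fun q B => Nat.sub_le _ _) h (A.ncard - ρ) using 1
    ext q
    refine Finset.sum_congr rfl fun B _ => ?_
    have := rowRank_le_ncard A B.1
    congr 1
    refine if_congr ?_ rfl rfl
    rw [defect]
    omega
  · convert graphsStar.zero_mem using 1
    ext q
    refine Finset.sum_eq_zero fun B _ => ?_
    have := rowRank_le_ncard A B.1
    rw [if_neg (by omega), mul_zero]

theorem rankCondCount_mem {V : Type} [Fintype V] (G : SimpleGraph V) (s : ℕ) (T : Set V)
    (L : List (Set V × ℕ)) : rankCondCount G s T L ∈ graphsStar := by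
  classical
  suffices H : ∀ (n : ℕ) {V : Type} [Fintype V] (G : SimpleGraph V) (T : Set V)
      (L : List (Set V × ℕ)), L.length = n → rankCondCount G s T L ∈ graphsStar from
    H _ G T L rfl
  intro n
  induction n with
  | zero =>
    intro V _ G T L hL
    rw [List.length_eq_zero_iff] at hL
    subst hL
    convert sum_rowRank_mem G T s (fun q B => if B.rank = s then 1 else 0)
      (fun k => defectSum_mem G T s k) using 1
    ext q
    refine Finset.sum_congr rfl fun B _ => ?_
    simp only [RankCond, List.not_mem_nil, false_imp_iff, implies_true, and_true, ite_and, mul_ite,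
      mul_one, mul_zero]
    split_ifs <;> rfl
  | succ n ih =>
    intro V _ G T L hL
    obtain ⟨⟨A, ρ⟩, L, rfl⟩ := List.exists_cons_of_length_eq_add_one hL
    rw [List.length_cons, Nat.add_right_cancel_iff] at hL
    -- Each new vertex adjacent to `A` trades one unit of `k` for a larger graph, with a condition
    -- list of the same length `n`.
    have key : ∀ (k : ℕ) {V : Type} [Fintype V] (G : SimpleGraph V) (T : Set V)
        (L : List (Set V × ℕ)) (A : Set V), L.length = n →
        (fun q : PrimePower => ∑ B : GraphSymm G (Fq q), (if RankCond s T L B.1 then 1 else 0) *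
          (q.1 : ℚ) ^ (k * defect A B.1)) ∈ graphsStar := by
      intro k
      induction k with
      | zero =>
        intro V _ G T L A hL
        simp only [Nat.zero_mul, pow_zero, mul_one]
        exact ih G T L hL
      | succ k ihk =>
        intro V _ G T L A hL
        refine mem_of_pow_mul_mem s ?_
        convert pow_mul_mem A.ncard (ihk (addVertex G A) (some '' T) (liftCond L) (some '' A)
          (by rw [liftCond, List.length_map, hL])) using 1
        ext q
        have h := sum_addVertex_rankCond (K := Fq q) G A s T L k
        rw [card_Fq] at h
        exact h.symm
    convert sum_rowRank_mem G A ρ (fun q B => if RankCond s T L B then 1 else 0)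
      (fun k => key k G T L A hL) using 1
    ext q
    refine Finset.sum_congr rfl fun B _ => ?_
    have h : RankCond s T ((A, ρ) :: L) B.1 ↔ RankCond s T L B.1 ∧ rowRank A B.1 = ρ := by
      simp only [RankCond, List.forall_mem_cons]
      tauto
    simp only [h, ite_and, mul_ite, mul_one, mul_zero]
    split_ifs <;> rfl

/-! ### Representations as symmetric matrices of given rank -/

section Frame

/-- The graph on `E ⊕ n` in which distinct elements of `n` are adjacent, and nothing else. -/
def frameGraph (E n : Type*) : SimpleGraph (E ⊕ n) where
  Adj i j := ∃ a b : n, a ≠ b ∧ i = Sum.inr a ∧ j = Sum.inr b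
  symm := ⟨fun _ _ ⟨a, b, h, hi, hj⟩ => ⟨b, a, h.symm, hj, hi⟩⟩
  loopless := ⟨fun _ ⟨_, _, h, hi, hj⟩ => h (Sum.inr_injective (hi.symm.trans hj))⟩

variable {E n K : Type*} [Fintype n] [DecidableEq n] [Field K]

/-- The Gram matrix of the rows of `F` and the standard basis, for a diagonal form with values
`d` on the dual basis. -/
def frameMatrix (F : Matrix E n K) (d : n → Kˣ) : Matrix (E ⊕ n) (E ⊕ n) K :=
  Matrix.fromBlocks (F * Matrix.diagonal (fun i => ((d i)⁻¹ : Kˣ).1) * F.transpose) F F.transpose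
    (Matrix.diagonal fun i => (d i : K))

theorem diagonal_inv_mul (d : n → Kˣ) :
    Matrix.diagonal (fun i => ((d i)⁻¹ : Kˣ).1) * Matrix.diagonal (fun i => (d i : K)) = 1 := by
  simp [Matrix.diagonal_mul_diagonal]

theorem frameMatrix_eq (F : Matrix E n K) (d : n → Kˣ) : frameMatrix F d =
    Matrix.fromRows (F * Matrix.diagonal (fun i => ((d i)⁻¹ : Kˣ).1)) 1 *
      Matrix.fromCols F.transpose (Matrix.diagonal fun i => (d i : K)) := by
  rw [Matrix.fromRows_mul_fromCols, Matrix.one_mul, Matrix.one_mul, frameMatrix,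
    Matrix.mul_assoc F _ (Matrix.diagonal _), diagonal_inv_mul, Matrix.mul_one]

theorem rowRank_mul_of_rightInverse {m : Type*} [Fintype m] (A : Set E)
    (P : Matrix E n K) {C : Matrix n m K} {C' : Matrix m n K} (h : C * C' = 1) :
    rowRank A (P * C) = rowRank A P := by
  refine rowRank_eq_of_map C.vecMulLinear (fun x y hxy => ?_) rfl
  have := congrArg (fun z => Matrix.vecMul z C') hxy
  simpa [Matrix.vecMul_vecMul, h] using this

theorem frameMatrix_mem (F : Matrix E n K) (d : n → Kˣ) : (frameMatrix F d).IsSymm ∧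
    ∀ v w, (frameGraph E n).Adj v w → frameMatrix F d v w = 0 := by
  refine ⟨Matrix.IsSymm.fromBlocks ?_ rfl (Matrix.isSymm_diagonal _), ?_⟩
  · rw [Matrix.IsSymm, Matrix.transpose_mul, Matrix.transpose_mul, Matrix.transpose_transpose,
      Matrix.diagonal_transpose, Matrix.mul_assoc]
  · rintro _ _ ⟨a, b, hab, rfl, rfl⟩
    rw [frameMatrix, Matrix.fromBlocks_apply₂₂, Matrix.diagonal_apply_ne _ hab]

theorem frameMatrix_injective {F F' : Matrix E n K} {d d' : n → Kˣ}
    (h : frameMatrix F d = frameMatrix F' d') : F = F' ∧ d = d' := by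
  obtain ⟨-, h1, -, h2⟩ := Matrix.fromBlocks_inj.1 h
  exact ⟨h1, funext fun i => Units.ext (congrFun (Matrix.diagonal_injective h2) i)⟩

variable [Fintype E]

/-- In the factorization `frameMatrix_eq` the right factor has a right inverse, so it preserves row
ranks. -/
theorem rowRank_frameMatrix (F : Matrix E n K) (d : n → Kˣ) (S : Set (E ⊕ n)) :
    rowRank S (frameMatrix F d) =
      rowRank S (Matrix.fromRows (F * Matrix.diagonal (fun i => ((d i)⁻¹ : Kˣ).1)) 1) := by
  rw [frameMatrix_eq]
  refine rowRank_mul_of_rightInverse (C' := Matrix.fromRows 0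
    (Matrix.diagonal (fun i => ((d i)⁻¹ : Kˣ).1))) _ _ ?_
  rw [Matrix.fromCols_mul_fromRows, Matrix.mul_zero, zero_add]
  simp [Matrix.diagonal_mul_diagonal]

theorem rowRank_frameMatrix_inl (F : Matrix E n K) (d : n → Kˣ) (A : Set E) :
    rowRank (Sum.inl '' A) (frameMatrix F d) = rowRank A F := by
  rw [rowRank_frameMatrix, ← rowRank_mul_of_rightInverse A F (diagonal_inv_mul d), rowRank, rowRank,
    Set.image_image]
  rfl

theorem rowRank_frameMatrix_inr (F : Matrix E n K) (d : n → Kˣ) :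
    rowRank (Set.range Sum.inr) (frameMatrix F d) = Fintype.card n := by
  have h := rowRank_univ (1 : Matrix n n K)
  rw [Matrix.rank_one] at h
  rw [rowRank_frameMatrix, ← h, rowRank, rowRank, ← Set.image_univ, Set.image_image]
  rfl

theorem rank_frameMatrix (F : Matrix E n K) (d : n → Kˣ) :
    (frameMatrix F d).rank = Fintype.card n := by
  refine le_antisymm ?_ ((rowRank_frameMatrix_inr F d).ge.trans (rowRank_le_rank _ _))
  rw [frameMatrix_eq]
  exact (Matrix.rank_mul_le_left _ _).trans (Matrix.rank_le_card_width _)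

/-- A symmetric matrix for `frameGraph E n` whose rank is the rank of its rows indexed by `n` and
equal to `|n|` is a `frameMatrix`. -/
theorem exists_eq_frameMatrix {B : Matrix (E ⊕ n) (E ⊕ n) K} (hB : B.IsSymm)
    (h0 : ∀ v w, (frameGraph E n).Adj v w → B v w = 0) (hr : B.rank = Fintype.card n)
    (hT : rowRank (Set.range Sum.inr) B = Fintype.card n) :
    ∃ (F : Matrix E n K) (d : n → Kˣ), frameMatrix F d = B := by
  have hrange : B.row '' Set.range Sum.inr = Set.range fun j => B (Sum.inr j) := by
    rw [← Set.range_comp]; rfl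
  have hspan : Submodule.span K (Set.range fun j => B (Sum.inr j)) =
      Submodule.span K (Set.range B.row) := by
    refine Submodule.eq_of_le_of_finrank_eq (Submodule.span_mono ?_) ?_
    · rintro _ ⟨j, rfl⟩
      exact ⟨Sum.inr j, rfl⟩
    · rw [← B.rank_eq_finrank_span_row, hr, ← hT, rowRank, hrange]
  have hli : LinearIndependent K fun j => B (Sum.inr j) := by
    rw [linearIndependent_iff_card_eq_finrank_span, Set.finrank, ← hrange]
    exact hT.symm
  have hY : ∀ e, ∃ y : n → K, ∑ j, y j • B (Sum.inr j) = B (Sum.inl e) := fun e => by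
    rw [← Submodule.mem_span_range_iff_exists_fun, hspan]
    exact Submodule.subset_span ⟨Sum.inl e, rfl⟩
  choose Y hY using hY
  have hYa : ∀ e v, ∑ j, Y e j * B (Sum.inr j) v = B (Sum.inl e) v := fun e v => by
    rw [← hY e, Finset.sum_apply]
    rfl
  have hoff : ∀ i j, i ≠ j → B (Sum.inr i) (Sum.inr j) = 0 := fun i j hij =>
    h0 _ _ ⟨i, j, hij, rfl, rfl⟩
  -- The block on `n` is diagonal, so the coefficients `Y` are read off from the entries of `B`.
  have hYd : ∀ e j, Y e j * B (Sum.inr j) (Sum.inr j) = B (Sum.inl e) (Sum.inr j) := fun e j => by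
    rw [← hYa, Finset.sum_eq_single j (fun i _ hi => by rw [hoff i j hi, mul_zero])
      (fun h => absurd (Finset.mem_univ j) h)]
  -- A zero diagonal entry would make the whole row `j` zero, against independence.
  have hd : ∀ j, B (Sum.inr j) (Sum.inr j) ≠ 0 := fun j hj => by
    refine hli.ne_zero j (funext ?_)
    rintro (e | i)
    · rw [hB.apply, ← hYd, hj, mul_zero]
      rfl
    · rcases eq_or_ne j i with rfl | hi
      · exact hj
      · exact hoff j i hi
  refine ⟨Matrix.of fun e j => B (Sum.inl e) (Sum.inr j), fun j => Units.mk0 _ (hd j), ?_⟩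
  ext (e | i) (e' | j)
  · rw [frameMatrix, Matrix.fromBlocks_apply₁₁, Matrix.mul_apply, ← hYa]
    refine Finset.sum_congr rfl fun j _ => ?_
    rw [Matrix.mul_diagonal, Matrix.transpose_apply, Matrix.of_apply, Matrix.of_apply, ← hYd,
      hB.apply (Sum.inr j) (Sum.inl e'), Units.val_inv_eq_inv_val, Units.val_mk0, mul_inv_cancel_right₀ (hd j)]
  · rfl
  · exact hB.apply _ _
  · rcases eq_or_ne i j with rfl | hij
    · rw [frameMatrix, Matrix.fromBlocks_apply₂₂, Matrix.diagonal_apply_eq, Units.val_mk0]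
    · rw [hoff i j hij, frameMatrix, Matrix.fromBlocks_apply₂₂, Matrix.diagonal_apply_ne _ hij]

end Frame

theorem rankCondCount_frameGraph {E : Type} [Fintype E] (s : ℕ) (ρ : Set E → ℕ)
    (L : List (Set (E ⊕ Fin s) × ℕ))
    (hL : ∀ p, p ∈ L ↔ ∃ A, p = (Sum.inl '' A, ρ A)) (q : PrimePower) :
    rankCondCount (frameGraph E (Fin s)) s (Set.range Sum.inr) L q = ((q.1 : ℚ) - 1) ^ s *
      Nat.card {F : Matrix E (Fin s) (Fq q) // ∀ A, rowRank A F = ρ A} := by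
  classical
  have hL' : ∀ B : Matrix (E ⊕ Fin s) (E ⊕ Fin s) (Fq q), (∀ p ∈ L, rowRank p.1 B = p.2) ↔
      ∀ A, rowRank (Sum.inl '' A) B = ρ A := fun B => by
    simp only [hL, forall_exists_index, forall_comm (α := Set _ × ℕ), forall_eq]
  let f : {F : Matrix E (Fin s) (Fq q) // ∀ A, rowRank A F = ρ A} × (Fin s → (Fq q)ˣ) →
      {B : GraphSymm (frameGraph E (Fin s)) (Fq q) // RankCond s (Set.range Sum.inr) L B.1} :=
    fun p => ⟨⟨frameMatrix p.1.1 p.2, frameMatrix_mem _ _⟩,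
      (rank_frameMatrix _ _).trans (Fintype.card_fin s),
      (rowRank_frameMatrix_inr _ _).trans (Fintype.card_fin s),
      (hL' _).2 fun A => (rowRank_frameMatrix_inl _ _ A).trans (p.1.2 A)⟩
  have hf : Function.Bijective f := by
    constructor
    · rintro ⟨⟨F, hF⟩, d⟩ ⟨⟨F', hF'⟩, d'⟩ h
      obtain ⟨rfl, rfl⟩ := frameMatrix_injective (congrArg (fun B => B.1.1) h)
      rfl
    · rintro ⟨⟨B, hB, h0⟩, hr, hT, hc⟩
      obtain ⟨F, d, rfl⟩ := exists_eq_frameMatrix hB h0 (hr.trans (Fintype.card_fin s).symm)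
        (hT.trans (Fintype.card_fin s).symm)
      exact ⟨(⟨F, fun A => (rowRank_frameMatrix_inl F d A).symm.trans ((hL' _).1 hc A)⟩, d), rfl⟩
  have hu : (Nat.card (Fq q)ˣ : ℚ) = (q.1 : ℚ) - 1 := by
    rw [Nat.card_units, card_Fq, Nat.cast_sub q.2.one_lt.le, Nat.cast_one]
  rw [rankCondCount, Finset.sum_boole, ← Fintype.card_subtype, ← Nat.card_eq_fintype_card,
    ← Nat.card_congr (Equiv.ofBijective f hf), Nat.card_prod, Nat.card_fun, Nat.card_fin,
    Nat.cast_mul, Nat.cast_pow, hu, mul_comm]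

theorem pointCount_repScheme_mem {α : Type} (M : Matroid α) [M.Finite] (s : ℕ) :
    pointCount (repScheme M s) ∈ graphsStar := by
  classical
  have : Finite M.E := M.ground_finite
  cases nonempty_fintype M.E
  have h := rankCondCount_mem (frameGraph M.E (Fin s)) s (Set.range Sum.inr)
    (Finset.univ.toList.map fun A : Set M.E => (Sum.inl '' A, rankFun M A))
  -- Division by `q - 1 = q ^ 1 - q ^ 0`, one factor at a time.
  have key : ∀ j : ℕ, (fun q : PrimePower => ((q.1 : ℚ) - 1) ^ j * pointCount (repScheme M s) q) ∈
      graphsStar → pointCount (repScheme M s) ∈ graphsStar := by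
    intro j
    induction j with
    | zero => simp
    | succ j ih =>
      intro hj
      refine ih (mem_of_pow_sub_pow_mul_mem (m := 1) (n := 0) one_ne_zero ?_)
      simpa only [pow_one, pow_zero, ← mul_assoc, ← pow_succ'] using hj
  refine key s ?_
  convert h using 1
  ext q
  rw [rankCondCount_frameGraph s (rankFun M) _ (fun p => by simp [eq_comm]), pointCount_repScheme]

end GraphMatroid

end

theorem mainTheorem3 : GraphMatroid.matroids ≤ GraphMatroid.graphsStar := by
  refine Submodule.span_le.2 ?_
  rintro _ ⟨α, M, hM, rfl⟩
  exact GraphMatroid.pointCount_repScheme_mem M _
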